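/- Let $k$ be a field of characteristic zero and $S=k[x,y]$. A central line arrangement $\mathcal A$ is a finite set of lines through the origin of the plane $k^2$. A defining polynomial of $\mathcal A$ is a product $Q\in S$ of linear forms, one for each line of $\mathcal A$, each having that line as its zero locus; it is unique up to a nonzero scalar. Let $\operatorname{Der}(\mathcal A)$ be the set of $k$-linear derivations $\delta$ of $S$ with $\delta(Q)\in QS$, and let $D(\mathcal A)$ be the subalgebra of $\operatorname{End}_k(S)$ generated by $\operatorname{Der}(\mathcal A)$ and the multiplications by elements of $S$; we view $S$ as a subalgebra of $D(\mathcal A)$. Let $\mathcal A$ and $\mathcal A'$ be two central line arrangements in $k^2$, with defining polynomials $Q$ and $Q'$. (1) The $k$-algebras $D(\mathcal A)$ and $D(\mathcal A')$ are isomorphic if and only if $\mathcal A$ and $\mathcal A'$ are linearly isomorphic, that is, if and only if there is a $g\in\mathrm{GL}_2(k)$ that carries the set of lines of $\mathcal A$ onto the set of lines of $\mathcal A'$. (2) Suppose that $\mathcal A$ has at least two lines. Then every isomorphism of $k$-algebras $\varphi:D(\mathcal A)\to D(\mathcal A')$ restricts to an algebra isomorphism $\psi:S\to S$ that is linear, in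 the sense that it maps the space $S_1$ of linear forms onto itself, and $\psi(Q)=cQ'$ for some nonzero $c\in k$. -/

import Mathlib

open MvPolynomial

noncomputable section

namespace LineArrangement

/-- A central arrangement of lines in the affine plane over `k`: a finite set of lines through
the origin of `k²`. -/
structure CentralLineArrangement (k : Type*) [Field k] where
  lines : Finset (Submodule k (Fin 2 → k))
  finrank_eq_one : ∀ L ∈ lines, Module.finrank k L = 1

variable {k : Type*} [Field k]

/-- `α ∈ k[x, y]` is a linear form whose zero locus is `L`. -/
def IsLinearFormOf (α : MvPolynomial (Fin 2) k) (L : Submodule k (Fin 2 → k)) : Prop :=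
  α.IsHomogeneous 1 ∧ ∀ p : Fin 2 → k, eval p α = 0 ↔ p ∈ L

theorem exists_isLinearFormOf (L : Submodule k (Fin 2 → k)) (hL : Module.finrank k L = 1) :
    ∃ α : MvPolynomial (Fin 2) k, IsLinearFormOf α L := by
  obtain ⟨v, hv, hspan⟩ := finrank_eq_one_iff'.1 hL
  refine ⟨C (v.1 1) * X 0 - C (v.1 0) * X 1, ?_, ?_⟩
  · exact ((isHomogeneous_X k 0).C_mul _).sub ((isHomogeneous_X k 1).C_mul _)
  · intro p
    simp only [map_sub, map_mul, eval_C, eval_X]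
    constructor
    · intro h
      have hne : v.1 0 ≠ 0 ∨ v.1 1 ≠ 0 := by
        by_contra! hc
        apply hv
        ext i
        fin_cases i
        · exact hc.1
        · exact hc.2
      rcases hne with h0 | h1
      · have : p = (p 0 / v.1 0) • v.1 := by
          ext i
          fin_cases i
          · simp [h0]
          · simp only [Fin.mk_one, Pi.smul_apply, smul_eq_mul]
            field_simp
            linear_combination -h
        rw [this]
        exact L.smul_mem _ v.2
      · have : p = (p 1 / v.1 1) • v.1 := by
          ext i
          fin_cases i
          · simp only [Fin.zero_eta, Pi.smul_apply, smul_eq_mul]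
            field_simp
            linear_combination h
          · simp [h1]
        rw [this]
        exact L.smul_mem _ v.2
    · intro h
      obtain ⟨c, hc⟩ := hspan ⟨p, h⟩
      have hp : p = c • v.1 := by rw [← Submodule.coe_smul, hc]
      rw [hp]
      simp only [Pi.smul_apply, smul_eq_mul]
      ring

namespace CentralLineArrangement

/-- `Q` is a defining polynomial of the arrangement: a product of linear forms, one for each
line of the arrangement, each having that line as its zero locus. -/
def IsDefiningPolynomial (A : CentralLineArrangement k) (Q : MvPolynomial (Fin 2) k) : Prop :=
  ∃ α : Submodule k (Fin 2 → k) → MvPolynomial (Fin 2) k,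
    (∀ L ∈ A.lines, IsLinearFormOf (α L) L) ∧ Q = ∏ L ∈ A.lines, α L

theorem exists_isDefiningPolynomial (A : CentralLineArrangement k) :
    ∃ Q, A.IsDefiningPolynomial Q := by
  classical
  choose f hf using fun L : A.lines => exists_isLinearFormOf L.1 (A.finrank_eq_one _ L.2)
  refine ⟨_, fun L => if h : L ∈ A.lines then f ⟨L, h⟩ else 0, ?_, rfl⟩
  intro L hL
  simpa [hL] using hf ⟨L, hL⟩

/-- A chosen defining polynomial; it is well defined up to a nonzero scalar. -/
def definingPolynomial (A : CentralLineArrangement k) : MvPolynomial (Fin 2) k :=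
  A.exists_isDefiningPolynomial.choose

theorem isDefiningPolynomial_definingPolynomial (A : CentralLineArrangement k) :
    A.IsDefiningPolynomial A.definingPolynomial :=
  A.exists_isDefiningPolynomial.choose_spec

/-- The derivations `d` of `S = k[x, y]` that are logarithmic along the arrangement:
`d Q ∈ Q S`. -/
def logDer (A : CentralLineArrangement k) :
    Submodule (MvPolynomial (Fin 2) k)
      (Derivation k (MvPolynomial (Fin 2) k) (MvPolynomial (Fin 2) k)) where
  carrier := {d | d A.definingPolynomial ∈ Ideal.span {A.definingPolynomial}}
  add_mem' := fun {a b} ha hb => by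
    have h : a A.definingPolynomial + b A.definingPolynomial ∈
        Ideal.span {A.definingPolynomial} := Ideal.add_mem _ ha hb
    simpa using h
  zero_mem' := by simp
  smul_mem' := fun c d hd => by
    have h : c * d A.definingPolynomial ∈ Ideal.span {A.definingPolynomial} :=
      Ideal.mul_mem_left _ c hd
    simpa using h

/-- The algebra of differential operators tangent to the arrangement: the subalgebra of
`End_k(S)`, `S = k[x, y]`, generated by the multiplications by elements of `S` and by the
logarithmic derivations. -/
def diffOps (A : CentralLineArrangement k) :
    Subalgebra k (Module.End k (MvPolynomial (Fin 2) k)) :=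
  Algebra.adjoin k
    (Set.range (fun f : MvPolynomial (Fin 2) k => LinearMap.mulLeft k f) ∪
      {δ | ∃ d ∈ A.logDer, δ = d.toLinearMap})

/-- The inclusion of `S = k[x, y]` in the algebra of tangent differential operators, as the
operators of multiplication. -/
def polyIncl (A : CentralLineArrangement k) : MvPolynomial (Fin 2) k →ₐ[k] A.diffOps :=
  (Algebra.lmul k (MvPolynomial (Fin 2) k)).codRestrict A.diffOps
    (fun f => Algebra.subset_adjoin (Or.inl ⟨f, rfl⟩))

/-- Two arrangements are linearly isomorphic if a linear automorphism of the plane carries the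
set of lines of the first onto that of the second. -/
def LinearlyIsomorphic (A A' : CentralLineArrangement k) : Prop :=
  ∃ g : (Fin 2 → k) ≃ₗ[k] (Fin 2 → k),
    (fun L : Submodule k (Fin 2 → k) => L.map g.toLinearMap) '' (A.lines : Set _) = A'.lines

end CentralLineArrangement

end LineArrangement

end

/-! The idea is to recover the lines from the ring structure of `D(A)` alone, through its normal
elements, the `u` with `u D = D u`. The nonzero ones are exactly the multiplications by polynomials
`h` that divide `d h` for every logarithmic `d` (`IsSemiInvariant.isNormalElement`,
`exists_isSemiInvariant_of_isNormalElement`), and the prime factors of such `h` are the linear forms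
of the lines, up to scalars.

That a normal element is a polynomial rests on commutators with multiplications. They act locally
nilpotently on `D(A)`, and in characteristic zero the resulting order is additive on products. If `u
f = g u`, comparing orders forces `g` to be a multiplication, and comparing leading terms forces `g
= f`; so `u` commutes with `S` and lies in it.

An isomorphism preserves normality and factorizations, so it carries linear forms of lines to linear
forms of lines (`exists_line`) and induces a bijection of lines. Two distinct lines give a basis of
the linear forms, so with at least two lines the isomorphism restricts to a linear automorphism of
`S` with `Q` going to a multiple of `Q'`, and the dual map of the plane matches the lines. With at
most one line, the number of lines already determines the arrangement up to `GL₂`. Conversely, a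
linear change of coordinates conjugates one algebra of operators into the other. -/

noncomputable section

namespace LineArrangement

/-! ### Iterated commutators with multiplications. -/

section Operators

variable {k S : Type*} [Field k] [CommRing S] [Algebra k S]

/-- The commutator `T ↦ [h, T]` of linear endomorphisms with the multiplication by `h`. -/
def adMul (k : Type*) {S : Type*} [Field k] [CommRing S] [Algebra k S] (h : S) :
    Module.End k (Module.End k S) :=
  LinearMap.mulLeft k (LinearMap.mulLeft k h) - LinearMap.mulRight k (LinearMap.mulLeft k h)

theorem adMul_apply (h : S) (T : Module.End k S) :
    adMul k h T = LinearMap.mulLeft k h * T - T * LinearMap.mulLeft k h := rfl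

theorem adMul_mul (h : S) (T U : Module.End k S) :
    adMul k h (T * U) = adMul k h T * U + T * adMul k h U := by
  simp only [adMul_apply, sub_mul, mul_sub, mul_assoc]
  abel

theorem adMul_mulLeft (h f : S) : adMul k h (LinearMap.mulLeft k f) = 0 := by
  ext g
  simp [adMul_apply, mul_left_comm]

theorem adMul_commute (h h' : S) : Commute (adMul k h) (adMul k h') := by
  ext T g
  simp only [Module.End.mul_apply, adMul_apply, LinearMap.sub_apply, LinearMap.mulLeft_apply,
    map_sub, mul_left_comm h h']
  ring

theorem adMul_pow_mul (h : S) (n : ℕ) (T U : Module.End k S) :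
    (adMul k h ^ n) (T * U) = ∑ ij ∈ Finset.HasAntidiagonal.antidiagonal n,
      n.choose ij.1 • ((adMul k h ^ ij.1) T * (adMul k h ^ ij.2) U) := by
  induction n with
  | zero => simp
  | succ n ih =>
    rw [Finset.sum_antidiagonal_choose_succ_nsmul
      (fun i j => (adMul k h ^ i) T * (adMul k h ^ j) U) n]
    simp only [pow_succ', Module.End.mul_apply, ih, map_sum, map_nsmul, adMul_mul, smul_add,
      Finset.sum_add_distrib]
    rw [add_comm]
    congr 1
    refine Finset.sum_congr rfl fun ⟨i, j⟩ hij ↦ ?_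
    rw [n.choose_symm_of_eq_add (Finset.HasAntidiagonal.mem_antidiagonal.1 hij).symm]

/-- The operators on which every commutator with a multiplication is nilpotent. -/
def LocallyAdNilpotent (T : Module.End k S) : Prop :=
  ∀ h : S, ∃ n, (adMul k h ^ n) T = 0

theorem adMul_pow_eq_zero_of_le {h : S} {T : Module.End k S} {m n : ℕ} (hmn : m ≤ n)
    (hT : (adMul k h ^ m) T = 0) : (adMul k h ^ n) T = 0 := by
  obtain ⟨j, rfl⟩ := Nat.exists_eq_add_of_le' hmn
  rw [pow_add, Module.End.mul_apply, hT, map_zero]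

theorem locallyAdNilpotent_mulLeft (f : S) : LocallyAdNilpotent (LinearMap.mulLeft k f) :=
  fun h => ⟨1, by rw [pow_one, adMul_mulLeft]⟩

theorem locallyAdNilpotent_derivation (d : Derivation k S S) :
    LocallyAdNilpotent (d.toLinearMap : Module.End k S) := by
  intro h
  refine ⟨2, ?_⟩
  have : adMul k h (d.toLinearMap : Module.End k S) = LinearMap.mulLeft k (-d h) := by
    ext g
    simp [adMul_apply, mul_comm]
  rw [pow_two, Module.End.mul_apply, this, adMul_mulLeft]

namespace LocallyAdNilpotent

theorem add {T U : Module.End k S} (hT : LocallyAdNilpotent T) (hU : LocallyAdNilpotent U) :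
    LocallyAdNilpotent (T + U) := by
  intro h
  obtain ⟨m, hm⟩ := hT h
  obtain ⟨n, hn⟩ := hU h
  exact ⟨max m n, by rw [map_add, adMul_pow_eq_zero_of_le (le_max_left m n) hm,
    adMul_pow_eq_zero_of_le (le_max_right m n) hn, add_zero]⟩

theorem mul {T U : Module.End k S} (hT : LocallyAdNilpotent T) (hU : LocallyAdNilpotent U) :
    LocallyAdNilpotent (T * U) := by
  intro h
  obtain ⟨m, hm⟩ := hT h
  obtain ⟨n, hn⟩ := hU h
  refine ⟨m + n, ?_⟩
  rw [adMul_pow_mul]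
  refine Finset.sum_eq_zero fun ij hij => ?_
  rw [Finset.HasAntidiagonal.mem_antidiagonal] at hij
  rcases le_or_gt m ij.1 with h1 | h1
  · rw [adMul_pow_eq_zero_of_le h1 hm, zero_mul, smul_zero]
  · rw [adMul_pow_eq_zero_of_le (by omega) hn, mul_zero, smul_zero]

theorem adMul_pow {T : Module.End k S} (hT : LocallyAdNilpotent T) (h : S) (n : ℕ) :
    LocallyAdNilpotent ((adMul k h ^ n) T) := by
  intro h'
  obtain ⟨m, hm⟩ := hT h'
  refine ⟨m, ?_⟩
  rw [← Module.End.mul_apply, ((adMul_commute h' h).pow_pow m n).eq, Module.End.mul_apply, hm,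
    map_zero]

/-- The last nonzero iterated commutator. -/
theorem exists_last {T : Module.End k S} (hT : LocallyAdNilpotent T) (h0 : T ≠ 0) (h : S) :
    ∃ n, (adMul k h ^ n) T ≠ 0 ∧ (adMul k h ^ (n + 1)) T = 0 := by
  classical
  have hex := hT h
  have hpos : Nat.find hex ≠ 0 := by
    intro hz
    have := Nat.find_spec hex
    rw [hz] at this
    exact h0 (by simpa using this)
  obtain ⟨n, hn⟩ := Nat.exists_eq_succ_of_ne_zero hpos
  refine ⟨n, Nat.find_min hex (by omega), ?_⟩
  have := Nat.find_spec hex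
  rwa [hn] at this

end LocallyAdNilpotent

/-- In the Leibniz expansion every term other than `(m, n)` has too high a power on one of the
factors. As the binomial coefficient is nonzero in characteristic zero, this gives multiplicativity
of leading terms. -/
theorem adMul_pow_add_mul {h : S} {T U : Module.End k S} {m n : ℕ}
    (hT : (adMul k h ^ (m + 1)) T = 0) (hU : (adMul k h ^ (n + 1)) U = 0) :
    (adMul k h ^ (m + n)) (T * U) =
      ((m + n).choose m : k) • ((adMul k h ^ m) T * (adMul k h ^ n) U) := by
  rw [adMul_pow_mul, Nat.cast_smul_eq_nsmul, Finset.sum_eq_single (m, n)]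
  · rintro ⟨i, j⟩ hij hne
    rw [Finset.HasAntidiagonal.mem_antidiagonal] at hij
    simp only at hij ⊢
    rcases lt_trichotomy i m with h1 | h1 | h1
    · rw [adMul_pow_eq_zero_of_le (show n + 1 ≤ j by omega) hU, mul_zero, smul_zero]
    · exact absurd (Prod.ext h1 (show j = n by omega)) hne
    · rw [adMul_pow_eq_zero_of_le (show m + 1 ≤ i by omega) hT, zero_mul, smul_zero]
  · intro hc
    simp at hc

/-- Multiplications are killed by `adMul k h`, so they behave as constants for this derivation, here
on the right and in the next lemma on the left. -/
theorem adMul_pow_mul_mulLeft (h f : S) (n : ℕ) (T : Module.End k S) :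
    (adMul k h ^ n) (T * LinearMap.mulLeft k f) =
      (adMul k h ^ n) T * LinearMap.mulLeft k f := by
  induction n with
  | zero => simp
  | succ n ih =>
    rw [pow_succ', Module.End.mul_apply, ih, adMul_mul, adMul_mulLeft, mul_zero, add_zero]
    rfl

theorem adMul_pow_mulLeft_mul (h f : S) (n : ℕ) (T : Module.End k S) :
    (adMul k h ^ n) (LinearMap.mulLeft k f * T) =
      LinearMap.mulLeft k f * (adMul k h ^ n) T := by
  induction n with
  | zero => simp
  | succ n ih =>
    rw [pow_succ', Module.End.mul_apply, ih, adMul_mul, adMul_mulLeft, zero_mul, zero_add]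
    rfl

theorem eq_mulLeft_of_adMul_eq_zero {T : Module.End k S} (hT : ∀ h, adMul k h T = 0) :
    T = LinearMap.mulLeft k (T 1) := by
  ext f
  have := LinearMap.congr_fun (hT f) 1
  simp only [adMul_apply, LinearMap.sub_apply, Module.End.mul_apply, LinearMap.mulLeft_apply,
    mul_one, LinearMap.zero_apply, sub_eq_zero] at this
  rw [LinearMap.mulLeft_apply, ← this, mul_comm]

end Operators

/-! ### Leading terms of operators on `k[x, y]`. -/

section Polynomial

variable {k : Type*} [Field k]

/-- The polynomials whose multiplication commutes with `T` form a subalgebra, and the variables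
generate. -/
theorem adMul_eq_zero_of_X {T : Module.End k (MvPolynomial (Fin 2) k)}
    (hT : ∀ i, adMul k (X i : MvPolynomial (Fin 2) k) T = 0) (h : MvPolynomial (Fin 2) k) :
    adMul k h T = 0 := by
  have key : ∀ a b : MvPolynomial (Fin 2) k,
      LinearMap.mulLeft k (a * b) = LinearMap.mulLeft k a * LinearMap.mulLeft k b :=
    fun a b => LinearMap.mulLeft_mul k _ a b
  simp only [adMul_apply, sub_eq_zero] at hT ⊢
  induction h using MvPolynomial.induction_on with
  | C a =>
    refine LinearMap.ext fun f => ?_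
    simp only [Module.End.mul_apply, LinearMap.mulLeft_apply, C_mul', map_smul]
  | add p q hp hq =>
    have : LinearMap.mulLeft k (p + q) = LinearMap.mulLeft k p + LinearMap.mulLeft k q := by
      ext; simp [add_mul]
    rw [this, add_mul, mul_add, hp, hq]
  | mul_X p i hp => rw [key, mul_assoc, hT i, ← mul_assoc, hp, mul_assoc]

/-- A nonzero operator is taken to a nonzero multiplication by iterated commutators. -/
theorem LocallyAdNilpotent.exists_mulLeft {T : Module.End k (MvPolynomial (Fin 2) k)}
    (hT : LocallyAdNilpotent T) (h0 : T ≠ 0) :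
    ∃ (m n : ℕ) (t : MvPolynomial (Fin 2) k), t ≠ 0 ∧
      (adMul k (X 0 : MvPolynomial (Fin 2) k) ^ (m + 1)) T = 0 ∧
      (adMul k (X 1 : MvPolynomial (Fin 2) k) ^ (n + 1))
        ((adMul k (X 0 : MvPolynomial (Fin 2) k) ^ m) T) = 0 ∧
      (adMul k (X 1 : MvPolynomial (Fin 2) k) ^ n)
        ((adMul k (X 0 : MvPolynomial (Fin 2) k) ^ m) T) = LinearMap.mulLeft k t := by
  obtain ⟨m, hm, hm'⟩ := hT.exists_last h0 (X 0)
  obtain ⟨n, hn, hn'⟩ := (hT.adMul_pow (X 0) m).exists_last hm (X 1)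
  have h := eq_mulLeft_of_adMul_eq_zero (adMul_eq_zero_of_X (T := (adMul k (X 1 :
    MvPolynomial (Fin 2) k) ^ n) ((adMul k (X 0 : MvPolynomial (Fin 2) k) ^ m) T)) ?_)
  · refine ⟨m, n, _, ?_, hm', hn', h⟩
    intro hz
    rw [hz] at h
    exact hn (h.trans (LinearMap.mulLeft_zero_eq_zero k _))
  · intro i
    fin_cases i
    · simp only [Fin.zero_eta]
      rw [← Module.End.mul_apply, ((adMul_commute (X 0) (X 1)).pow_right n).eq,
        Module.End.mul_apply, ← Module.End.mul_apply (adMul k (X 0)), ← pow_succ', hm', map_zero]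
    · simp only [Fin.mk_one]
      rw [← Module.End.mul_apply, ← pow_succ', hn']

variable [CharZero k]

/-- Taking leading terms for `X 0` and then for `X 1` turns `T * U = 0` into `t * u = 0` for nonzero
polynomials `t` and `u`. -/
theorem LocallyAdNilpotent.mul_ne_zero {T U : Module.End k (MvPolynomial (Fin 2) k)}
    (hT : LocallyAdNilpotent T) (hU : LocallyAdNilpotent U) (hT0 : T ≠ 0) (hU0 : U ≠ 0) :
    T * U ≠ 0 := by
  intro hz
  obtain ⟨m, n, t, ht, h1, h2, h3⟩ := hT.exists_mulLeft hT0
  obtain ⟨m', n', u, hu, h1', h2', h3'⟩ := hU.exists_mulLeft hU0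
  have e1 := adMul_pow_add_mul h1 h1'
  rw [hz, map_zero, eq_comm, smul_eq_zero] at e1
  have e1 := e1.resolve_left (Nat.cast_ne_zero.2 (Nat.choose_pos (Nat.le_add_right _ _)).ne')
  have e2 := adMul_pow_add_mul h2 h2'
  rw [e1, map_zero, eq_comm, smul_eq_zero] at e2
  have e2 := e2.resolve_left (Nat.cast_ne_zero.2 (Nat.choose_pos (Nat.le_add_right _ _)).ne')
  rw [h3, h3'] at e2
  have := LinearMap.congr_fun e2 1
  simp [ht, hu] at this

/-- An operator that quasi-commutes with all multiplications is a multiplication. -/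
theorem LocallyAdNilpotent.eq_mulLeft_of_quasicommute
    {u : Module.End k (MvPolynomial (Fin 2) k)} (hu : LocallyAdNilpotent u) (hu0 : u ≠ 0)
    (H : ∀ f : MvPolynomial (Fin 2) k, ∃ g : Module.End k (MvPolynomial (Fin 2) k),
      LocallyAdNilpotent g ∧ u * LinearMap.mulLeft k f = g * u) :
    u = LinearMap.mulLeft k (u 1) := by
  apply eq_mulLeft_of_adMul_eq_zero
  intro f
  obtain ⟨g, hg, hgu⟩ := H f
  -- Comparison of orders: if `g` had order `n > 0` for `h` and `u` order `m`, then `g * u` would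
  -- have order `n + m`, whereas `u * f` is already killed by the `(m + 1)`-st commutator.
  have hgm : g = LinearMap.mulLeft k (g 1) := by
    apply eq_mulLeft_of_adMul_eq_zero
    intro h
    by_contra hne
    have hg0 : g ≠ 0 := by
      rintro rfl
      exact hne (map_zero _)
    obtain ⟨n, hn, hn'⟩ := hg.exists_last hg0 h
    obtain ⟨m, hm, hm'⟩ := hu.exists_last hu0 h
    have hn1 : n ≠ 0 := by
      rintro rfl
      exact hne (by simpa using hn')
    have e := adMul_pow_add_mul hn' hm'
    rw [← hgu, adMul_pow_mul_mulLeft, adMul_pow_eq_zero_of_le (by omega) hm', zero_mul, eq_comm,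
      smul_eq_zero] at e
    exact (hg.adMul_pow h n).mul_ne_zero (hu.adMul_pow h m) hn hm
      (e.resolve_left (Nat.cast_ne_zero.2 (Nat.choose_pos (Nat.le_add_right _ _)).ne'))
  obtain ⟨m, n, t, ht, -, -, h3⟩ := hu.exists_mulLeft hu0
  rw [hgm] at hgu
  -- The leading term of `u * f = g * u` reads `t * f = t * g 1`, and `t` cancels.
  have e := congrArg (fun T => (adMul k (X 1 : MvPolynomial (Fin 2) k) ^ n)
        ((adMul k (X 0 : MvPolynomial (Fin 2) k) ^ m) T)) hgu
  simp only [adMul_pow_mul_mulLeft, adMul_pow_mulLeft_mul, h3] at e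
  have e := LinearMap.congr_fun e 1
  simp only [Module.End.mul_apply, LinearMap.mulLeft_apply, mul_one, mul_comm _ t] at e
  have e := mul_left_cancel₀ ht e
  rw [adMul_apply, hgu, e, sub_self]

end Polynomial

/-! ### Linear forms, divisibility and partial derivatives. -/

section LinearForms

variable {k : Type*} [Field k]

theorem isUnit_C {c : k} (hc : c ≠ 0) : IsUnit (C c : MvPolynomial (Fin 2) k) :=
  (IsUnit.mk0 c hc).map C

theorem exists_eq_of_isHomogeneous_one {α : MvPolynomial (Fin 2) k} (hα : α.IsHomogeneous 1) :
    ∃ a b : k, α = C a * X 0 + C b * X 1 := by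
  have h : α ∈ Submodule.span k (Set.range (X : Fin 2 → MvPolynomial (Fin 2) k)) := by
    rwa [← homogeneousSubmodule_one_eq_span_X, mem_homogeneousSubmodule]
  obtain ⟨c, hc⟩ := Submodule.mem_span_range_iff_exists_fun k |>.1 h
  refine ⟨c 0, c 1, ?_⟩
  rw [← hc, Fin.sum_univ_two, C_mul', C_mul']

theorem prime_of_isHomogeneous_one {α : MvPolynomial (Fin 2) k} (hα : α.IsHomogeneous 1)
    (h0 : α ≠ 0) : Prime α := by
  rw [← irreducible_iff_prime]
  refine irreducible_of_totalDegree_eq_one (hα.totalDegree h0) fun x hx => ?_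
  refine IsUnit.mk0 x ?_
  rintro rfl
  apply h0
  ext i
  rw [zero_dvd_iff.1 (hx i), coeff_zero]

namespace IsLinearFormOf

variable {α β : MvPolynomial (Fin 2) k} {L L' : Submodule k (Fin 2 → k)}

theorem ne_zero (hα : IsLinearFormOf α L) (hL : Module.finrank k L = 1) : α ≠ 0 := by
  rintro rfl
  have : L = ⊤ := by
    ext p
    simpa using (hα.2 p).symm
  rw [this, finrank_top, Module.finrank_fin_fun] at hL
  omega

theorem prime (hα : IsLinearFormOf α L) (hL : Module.finrank k L = 1) : Prime α :=
  prime_of_isHomogeneous_one hα.1 (hα.ne_zero hL)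

theorem C_mul (hα : IsLinearFormOf α L) {c : k} (hc : c ≠ 0) :
    IsLinearFormOf (C c * α) L :=
  ⟨hα.1.C_mul c, fun p => by simp [hc, hα.2 p]⟩

theorem exists_eq_C_mul (hα : IsLinearFormOf α L) (hβ : IsLinearFormOf β L)
    (hL : Module.finrank k L = 1) : ∃ c : k, c ≠ 0 ∧ α = C c * β := by
  have hα0 := hα.ne_zero hL
  have hβ0 := hβ.ne_zero hL
  obtain ⟨a, b, rfl⟩ := exists_eq_of_isHomogeneous_one hα.1
  obtain ⟨a', b', rfl⟩ := exists_eq_of_isHomogeneous_one hβ.1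
  -- The vector `(b', -a')` spans the zero locus of the second form.
  have h1 : eval ![b', -a'] (C a * X 0 + C b * X 1) = 0 := by
    rw [hα.2, ← hβ.2]
    simp
    ring
  have h2 : a * b' = b * a' := by
    simp at h1
    linear_combination h1
  have h3 : ∃ c, C a * X 0 + C b * X 1 =
      (C c * (C a' * X 0 + C b' * X 1) : MvPolynomial (Fin 2) k) := by
    by_cases ha' : a' = 0
    · have hb' : b' ≠ 0 := by
        rintro rfl
        simp [ha'] at hβ0
      refine ⟨b / b', ?_⟩
      have e1 : a = b / b' * a' := by
        rw [div_mul_eq_mul_div, eq_div_iff hb', h2]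
      have e2 : b = b / b' * b' := (div_mul_cancel₀ b hb').symm
      rw [mul_add, ← mul_assoc, ← mul_assoc, ← map_mul, ← map_mul, ← e1, ← e2]
    · refine ⟨a / a', ?_⟩
      have e1 : b = a / a' * b' := by
        rw [div_mul_eq_mul_div, eq_div_iff ha', h2]
      have e2 : a = a / a' * a' := (div_mul_cancel₀ a ha').symm
      rw [mul_add, ← mul_assoc, ← mul_assoc, ← map_mul, ← map_mul, ← e1, ← e2]
  obtain ⟨c, hc⟩ := h3
  refine ⟨c, ?_, hc⟩
  rintro rfl
  exact hα0 (by rw [hc, map_zero, zero_mul])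

theorem eq_of_dvd (hα : IsLinearFormOf α L) (hβ : IsLinearFormOf β L')
    (hL : Module.finrank k L = 1) (hL' : Module.finrank k L' = 1) (h : α ∣ β) : L = L' := by
  obtain ⟨γ, rfl⟩ := h
  refine Submodule.eq_of_le_of_finrank_eq (fun p hp => ?_) (hL.trans hL'.symm)
  rw [← hβ.2, map_mul, (hα.2 p).2 hp, zero_mul]

end IsLinearFormOf

/-- A nonzero partial derivative has smaller total degree than `p`, hence is not a multiple of it.
-/
theorem pderiv_eq_zero_of_dvd {p : MvPolynomial (Fin 2) k} {i : Fin 2} (h : p ∣ pderiv i p) :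
    pderiv i p = 0 := by
  by_contra hne
  obtain ⟨m, hm⟩ := Finset.exists_mem_eq_sup' (support_nonempty.2 hne) (fun s => s.sum fun _ e => e)
  have h1 := totalDegree_le_of_dvd_of_isDomain h hne
  have h2 : (pderiv i p).totalDegree = m.sum fun _ e => e := by
    rw [← hm.2, totalDegree, Finset.sup'_eq_sup]
  have h3 : m + Finsupp.single i 1 ∈ p.support := by
    have := hm.1
    rw [mem_support_iff, coeff_pderiv] at this
    exact mem_support_iff.2 (left_ne_zero_of_mul this)
  have h4 := le_totalDegree h3
  rw [Finsupp.sum_add_index' (fun _ => rfl) (fun _ _ _ => rfl), Finsupp.sum_single_index rfl]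
    at h4
  omega

theorem eq_C_of_pderiv_eq_zero [CharZero k] {p : MvPolynomial (Fin 2) k}
    (h : ∀ i, pderiv i p = 0) : p = C (coeff 0 p) := by
  ext m
  rw [coeff_C]
  split_ifs with hm
  · rw [hm]
  · obtain ⟨i, hi⟩ := Finsupp.ne_iff.1 (Ne.symm hm)
    have hle : Finsupp.single i 1 ≤ m := by
      rw [Finsupp.single_le_iff]
      exact Nat.one_le_iff_ne_zero.2 hi
    have := congrArg (coeff (m - Finsupp.single i 1)) (h i)
    rw [coeff_pderiv, tsub_add_cancel_of_le hle, coeff_zero] at this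
    exact (mul_eq_zero.1 this).resolve_right (Nat.cast_add_one_ne_zero _)

end LinearForms

/-! ### Normal elements and semi-invariant polynomials. -/

/-- The elements `u` of a ring `R` with `u R = R u`. -/
def IsNormalElement {R : Type*} [Mul R] (u : R) : Prop :=
  (∀ a, ∃ b, u * a = b * u) ∧ ∀ a, ∃ b, a * u = u * b

theorem IsNormalElement.map {R R' F : Type*} [Mul R] [Mul R'] [EquivLike F R R']
    [MulEquivClass F R R'] {u : R} (hu : IsNormalElement u) (φ : F) : IsNormalElement (φ u) := by
  refine ⟨fun a => ?_, fun a => ?_⟩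
  · obtain ⟨a, rfl⟩ := EquivLike.surjective φ a
    obtain ⟨b, hb⟩ := hu.1 a
    exact ⟨φ b, by rw [← map_mul, hb, map_mul]⟩
  · obtain ⟨a, rfl⟩ := EquivLike.surjective φ a
    obtain ⟨b, hb⟩ := hu.2 a
    exact ⟨φ b, by rw [← map_mul, hb, map_mul]⟩

namespace CentralLineArrangement

variable {k : Type*} [Field k] (A : CentralLineArrangement k)

/-- The nonzero polynomials `h` that divide all their images under logarithmic derivations. -/
def IsSemiInvariant (h : MvPolynomial (Fin 2) k) : Prop :=
  h ≠ 0 ∧ ∀ d ∈ A.logDer, h ∣ d h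

theorem mem_logDer {A : CentralLineArrangement k}
    {d : Derivation k (MvPolynomial (Fin 2) k) (MvPolynomial (Fin 2) k)} :
    d ∈ A.logDer ↔ A.definingPolynomial ∣ d A.definingPolynomial :=
  Ideal.mem_span_singleton

theorem dvd_definingPolynomial {α : MvPolynomial (Fin 2) k} {L : Submodule k (Fin 2 → k)}
    (hL : L ∈ A.lines) (hα : IsLinearFormOf α L) : α ∣ A.definingPolynomial := by
  obtain ⟨β, hβ, hQ⟩ := A.isDefiningPolynomial_definingPolynomial
  obtain ⟨c, hc, h⟩ := (hβ L hL).exists_eq_C_mul hα (A.finrank_eq_one L hL)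
  rw [hQ]
  exact (Dvd.intro_left _ h.symm).trans (Finset.dvd_prod_of_mem β hL)

variable {A} in
theorem IsDefiningPolynomial.ne_zero {Q : MvPolynomial (Fin 2) k}
    (hQ : A.IsDefiningPolynomial Q) : Q ≠ 0 := by
  obtain ⟨β, hβ, rfl⟩ := hQ
  exact Finset.prod_ne_zero_iff.2 fun L hL => (hβ L hL).ne_zero (A.finrank_eq_one L hL)

theorem exists_isLinearFormOf_of_dvd {p : MvPolynomial (Fin 2) k} (hp : Prime p)
    (h : p ∣ A.definingPolynomial) : ∃ L ∈ A.lines, ∃ α, IsLinearFormOf α L ∧ α ∣ p := by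
  obtain ⟨β, hβ, hQ⟩ := A.isDefiningPolynomial_definingPolynomial
  rw [hQ] at h
  obtain ⟨L, hL, hdvd⟩ := hp.exists_mem_finset_dvd h
  exact ⟨L, hL, β L, hβ L hL,
    ((hp.associated_of_dvd ((hβ L hL).prime (A.finrank_eq_one L hL)) hdvd).symm).dvd⟩

/-- Write `Q = c α R` with `R` the product over the other lines. Modulo `α`, `d Q` is `c R (d α)`,
and the prime `α` does not divide `R` because the lines are distinct. -/
theorem isSemiInvariant_of_isLinearFormOf {α : MvPolynomial (Fin 2) k}
    {L : Submodule k (Fin 2 → k)} (hL : L ∈ A.lines) (hα : IsLinearFormOf α L) :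
    A.IsSemiInvariant α := by
  classical
  have hprime := hα.prime (A.finrank_eq_one L hL)
  refine ⟨hprime.ne_zero, fun d hd => ?_⟩
  obtain ⟨β, hβ, hQ⟩ := A.isDefiningPolynomial_definingPolynomial
  obtain ⟨c, hc, h⟩ := (hβ L hL).exists_eq_C_mul hα (A.finrank_eq_one L hL)
  have hdvd := (A.dvd_definingPolynomial hL hα).trans (mem_logDer.1 hd)
  rw [hQ, ← Finset.mul_prod_erase _ _ hL, h, Derivation.leibniz, Derivation.leibniz] at hdvd
  simp only [smul_eq_mul] at hdvd
  have hdC : d (C c) = 0 := d.map_algebraMap c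
  rw [hdC, mul_zero, add_zero] at hdvd
  have h2 := (dvd_add_right (Dvd.intro_left (C c) rfl |>.mul_right _)).1 hdvd
  rcases hprime.dvd_or_dvd h2 with h3 | h3
  · obtain ⟨L', hL', hdvd'⟩ := hprime.exists_mem_finset_dvd h3
    rw [Finset.mem_erase] at hL'
    exact absurd (hα.eq_of_dvd (hβ L' hL'.2) (A.finrank_eq_one L hL)
      (A.finrank_eq_one L' hL'.2) hdvd') hL'.1.symm
  · exact (hprime.dvd_or_dvd h3).resolve_left
      fun h4 => hprime.not_isUnit (isUnit_of_dvd_unit h4 (isUnit_C hc))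

variable {A} in
theorem IsSemiInvariant.of_mul {α h : MvPolynomial (Fin 2) k} (hα : A.IsSemiInvariant α)
    (hαh : A.IsSemiInvariant (α * h)) : A.IsSemiInvariant h := by
  refine ⟨right_ne_zero_of_mul hαh.1, fun d hd => ?_⟩
  have h1 := hαh.2 d hd
  rw [Derivation.leibniz, smul_eq_mul, smul_eq_mul] at h1
  obtain ⟨γ, hγ⟩ := hα.2 d hd
  have h2 : α * h ∣ h * d α := by
    rw [hγ]
    exact ⟨γ, by ring⟩
  exact (mul_dvd_mul_iff_left hα.1).1 ((dvd_add_left h2).1 h1)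

/-- These derivations exist for every arrangement and suffice to bound the prime factors of
semi-invariants. -/
theorem smul_pderiv_mem_logDer (i : Fin 2) : A.definingPolynomial • pderiv i ∈ A.logDer := by
  rw [mem_logDer, Derivation.smul_apply]
  exact Dvd.intro _ rfl

variable {A} in
/-- The prime factors of the semi-invariants are linear forms of the lines. -/
theorem IsSemiInvariant.dvd_definingPolynomial [CharZero k] {h p : MvPolynomial (Fin 2) k}
    (hh : A.IsSemiInvariant h) (hp : Prime p) (hph : p ∣ h) : p ∣ A.definingPolynomial := by
  by_contra hQ
  obtain ⟨g, hfac, hg⟩ :=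
    (FiniteMultiplicity.of_prime_left hp hh.1).exists_eq_pow_mul_and_not_dvd
  generalize multiplicity p h = n at hfac
  subst hfac
  obtain ⟨n, rfl⟩ : ∃ m, n = m + 1 := by
    refine Nat.exists_eq_succ_of_ne_zero ?_
    rintro rfl
    rw [pow_zero, one_mul] at hph
    exact hg hph
  -- With `h = p ^ (n + 1) * g`, apply `Q ∂ᵢ` and cancel `p ^ n`: then `p` divides `(n + 1) Q g
  -- ∂ᵢp`. It divides neither `Q` nor `g`, so it divides `∂ᵢp`, which must vanish. A prime with both
  -- partials zero would be constant.
  have key : ∀ i, pderiv i p = 0 := by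
    intro i
    apply pderiv_eq_zero_of_dvd
    have h1 := hh.2 _ (A.smul_pderiv_mem_logDer i)
    rw [Derivation.smul_apply, smul_eq_mul, Derivation.leibniz, Derivation.leibniz_pow] at h1
    simp only [smul_eq_mul, nsmul_eq_mul, Nat.add_sub_cancel] at h1
    have h2 : p ^ n * p ∣ p ^ n * (A.definingPolynomial * (p * pderiv i g +
        g * (((n + 1 : ℕ) : MvPolynomial (Fin 2) k) * pderiv i p))) := by
      rw [← pow_succ]
      refine (Dvd.intro g rfl).trans (h1.trans (dvd_of_eq ?_))
      ring
    have h3 := (mul_dvd_mul_iff_left (pow_ne_zero n hp.ne_zero)).1 h2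
    have h4 := (hp.dvd_or_dvd h3).resolve_left hQ
    have h5 := (dvd_add_right (Dvd.intro _ rfl)).1 h4
    have h6 := (hp.dvd_or_dvd h5).resolve_left hg
    refine (hp.dvd_or_dvd h6).resolve_left fun h7 => hp.not_isUnit (isUnit_of_dvd_unit h7 ?_)
    rw [← map_natCast (C : k →+* MvPolynomial (Fin 2) k)]
    exact isUnit_C (Nat.cast_ne_zero.2 n.succ_ne_zero)
  have hC := eq_C_of_pderiv_eq_zero key
  apply hp.not_isUnit
  rw [hC]
  refine isUnit_C fun h0 => hp.ne_zero ?_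
  rw [hC, h0, map_zero]

variable {A} in
theorem IsSemiInvariant.exists_isLinearFormOf_dvd [CharZero k] {h : MvPolynomial (Fin 2) k}
    (hh : A.IsSemiInvariant h) (hu : ¬ IsUnit h) :
    ∃ L ∈ A.lines, ∃ α, IsLinearFormOf α L ∧ α ∣ h := by
  obtain ⟨p, hp, hph⟩ := WfDvdMonoid.exists_irreducible_factor hu hh.1
  obtain ⟨L, hL, α, hα, hαp⟩ :=
    A.exists_isLinearFormOf_of_dvd hp.prime (hh.dvd_definingPolynomial hp.prime hph)
  exact ⟨L, hL, α, hα, hαp.trans hph⟩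

theorem locallyAdNilpotent (T : A.diffOps) : LocallyAdNilpotent T.1 := by
  refine Algebra.adjoin_induction (p := fun T _ => LocallyAdNilpotent T) ?_ ?_ ?_ ?_ T.2
  · rintro _ (⟨f, rfl⟩ | ⟨d, -, rfl⟩)
    · exact locallyAdNilpotent_mulLeft f
    · exact locallyAdNilpotent_derivation d
  · intro r
    have : algebraMap k (Module.End k (MvPolynomial (Fin 2) k)) r =
        LinearMap.mulLeft k (C r) := by
      refine LinearMap.ext fun f => ?_
      rw [Module.algebraMap_end_apply, LinearMap.mulLeft_apply, C_mul']
    rw [this]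
    exact locallyAdNilpotent_mulLeft _
  · intro T U _ _ hT hU
    exact hT.add hU
  · intro T U _ _ hT hU
    exact hT.mul hU

theorem polyIncl_injective : Function.Injective A.polyIncl := by
  intro f g h
  have : f * 1 = g * 1 := LinearMap.congr_fun (congrArg Subtype.val h) 1
  simpa using this

theorem polyIncl_C (c : k) : A.polyIncl (C c) = algebraMap k A.diffOps c :=
  A.polyIncl.commutes c

/-- The logarithmic derivations as elements of the algebra of differential operators. -/
def derIncl (d : A.logDer) : A.diffOps :=
  ⟨d.1.toLinearMap, Algebra.subset_adjoin (Or.inr ⟨d.1, d.2, rfl⟩)⟩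

theorem diffOps_induction {p : A.diffOps → Prop} (hS : ∀ f, p (A.polyIncl f))
    (hD : ∀ d, p (A.derIncl d)) (hadd : ∀ T U, p T → p U → p (T + U))
    (hmul : ∀ T U, p T → p U → p (T * U)) (T : A.diffOps) : p T := by
  obtain ⟨T, hT⟩ := T
  refine Algebra.adjoin_induction (p := fun T hT => p ⟨T, hT⟩) ?_ ?_ ?_ ?_ hT
  · rintro _ (⟨f, rfl⟩ | ⟨d, hd, rfl⟩)
    · exact hS f
    · exact hD ⟨d, hd⟩
  · intro r
    have := hS (C r)
    rwa [polyIncl_C] at this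
  · intro T U hT hU h1 h2
    exact hadd _ _ h1 h2
  · intro T U hT hU h1 h2
    exact hmul _ _ h1 h2

theorem derIncl_mul_polyIncl (d : A.logDer) (h : MvPolynomial (Fin 2) k) :
    A.derIncl d * A.polyIncl h = A.polyIncl h * A.derIncl d + A.polyIncl (d.1 h) := by
  apply Subtype.ext
  refine LinearMap.ext fun f => ?_
  change d.1 (h * f) = h * d.1 f + d.1 h * f
  rw [Derivation.leibniz, smul_eq_mul, smul_eq_mul, mul_comm f]

-- If `d h = h g`, then `d ∘ h = h ∘ (d + g)` and `h ∘ d = (d - g) ∘ h`. The operators that can be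
-- moved across `h` are closed under sums and products, so the generators suffice.
variable {A} in
theorem IsSemiInvariant.isNormalElement {h : MvPolynomial (Fin 2) k} (hh : A.IsSemiInvariant h) :
    IsNormalElement (A.polyIncl h) := by
  have hd : ∀ d : A.logDer, ∃ g, A.derIncl d * A.polyIncl h =
      A.polyIncl h * A.derIncl d + A.polyIncl h * A.polyIncl g := by
    intro d
    obtain ⟨g, hg⟩ := hh.2 d.1 d.2
    exact ⟨g, by rw [derIncl_mul_polyIncl, hg, map_mul]⟩
  constructor
  · refine A.diffOps_induction ?_ ?_ ?_ ?_
    · exact fun f => ⟨A.polyIncl f, by rw [← map_mul, mul_comm, map_mul]⟩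
    · intro d
      obtain ⟨g, hg⟩ := hd d
      refine ⟨A.derIncl d + A.polyIncl (-g), ?_⟩
      rw [add_mul, hg, ← map_mul, ← map_mul, add_assoc, ← map_add,
        show h * g + -g * h = 0 by ring, map_zero, add_zero]
    · rintro T U ⟨T', hT⟩ ⟨U', hU⟩
      exact ⟨T' + U', by rw [mul_add, add_mul, hT, hU]⟩
    · rintro T U ⟨T', hT⟩ ⟨U', hU⟩
      exact ⟨T' * U', by rw [← mul_assoc, hT, mul_assoc, hU, mul_assoc]⟩
  · refine A.diffOps_induction ?_ ?_ ?_ ?_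
    · exact fun f => ⟨A.polyIncl f, by rw [← map_mul, mul_comm, map_mul]⟩
    · intro d
      obtain ⟨g, hg⟩ := hd d
      exact ⟨A.derIncl d + A.polyIncl g, by rw [hg, mul_add]⟩
    · rintro T U ⟨T', hT⟩ ⟨U', hU⟩
      exact ⟨T' + U', by rw [mul_add, add_mul, hT, hU]⟩
    · rintro T U ⟨T', hT⟩ ⟨U', hU⟩
      exact ⟨T' * U', by rw [mul_assoc, hU, ← mul_assoc, hT, mul_assoc]⟩

variable {A} in
/-- The nonzero normal elements are the semi-invariant polynomials. -/
theorem exists_isSemiInvariant_of_isNormalElement [CharZero k] {u : A.diffOps}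
    (hu : IsNormalElement u) (hu0 : u ≠ 0) : ∃ h, A.IsSemiInvariant h ∧ u = A.polyIncl h := by
  have hu0' : u.1 ≠ 0 := fun h => hu0 (Subtype.ext h)
  have key := (A.locallyAdNilpotent u).eq_mulLeft_of_quasicommute hu0' (fun f => by
    obtain ⟨g, hg⟩ := hu.1 (A.polyIncl f)
    exact ⟨g.1, A.locallyAdNilpotent g, congrArg Subtype.val hg⟩)
  have hu' : u = A.polyIncl (u.1 1) := Subtype.ext key
  refine ⟨u.1 1, ⟨?_, fun d hd => ?_⟩, hu'⟩
  · intro h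
    rw [h, map_zero] at hu'
    exact hu0 hu'
  · obtain ⟨b, hb⟩ := hu.2 (A.derIncl ⟨d, hd⟩)
    refine ⟨b.1 1, ?_⟩
    have e : (d.toLinearMap * u.1) 1 = (u.1 * b.1) 1 :=
      LinearMap.congr_fun (congrArg Subtype.val hb) 1
    have e2 : u.1 (b.1 1) = u.1 1 * b.1 1 := LinearMap.congr_fun key (b.1 1)
    rw [← e2]
    exact e

end CentralLineArrangement

/-! ### The action of an isomorphism on lines and on polynomials. -/

namespace CentralLineArrangement

variable {k : Type*} [Field k] {A A' : CentralLineArrangement k}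

theorem _root_.LineArrangement.IsLinearFormOf.not_eq_C {α : MvPolynomial (Fin 2) k}
    {L : Submodule k (Fin 2 → k)} (hα : IsLinearFormOf α L) (hL : Module.finrank k L = 1) (c : k) :
    α ≠ C c := by
  rintro rfl
  rcases eq_or_ne c 0 with rfl | hc
  · exact hα.ne_zero hL C_0
  · exact (hα.prime hL).not_isUnit (isUnit_C hc)

theorem apply_polyIncl_C (φ : A.diffOps ≃ₐ[k] A'.diffOps) (c : k) :
    φ (A.polyIncl (C c)) = A'.polyIncl (C c) := by
  rw [polyIncl_C, polyIncl_C, φ.commutes]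

theorem eq_C_of_apply_polyIncl_eq (φ : A.diffOps ≃ₐ[k] A'.diffOps) {f : MvPolynomial (Fin 2) k}
    {c : k} (h : φ (A.polyIncl f) = A'.polyIncl (C c)) : f = C c := by
  rw [← apply_polyIncl_C φ] at h
  exact A.polyIncl_injective (φ.injective h)

/-- The linear forms of two distinct lines span the linear forms. -/
theorem _root_.LineArrangement.span_pair_eq {α β : MvPolynomial (Fin 2) k}
    {L M : Submodule k (Fin 2 → k)} (hα : IsLinearFormOf α L) (hβ : IsLinearFormOf β M)
    (hL : Module.finrank k L = 1) (hM : Module.finrank k M = 1) (hLM : L ≠ M) :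
    Submodule.span k {α, β} = homogeneousSubmodule (Fin 2) k 1 := by
  have hind : LinearIndependent k ![α, β] := by
    rw [LinearIndependent.pair_iff' (hα.ne_zero hL)]
    intro c hc
    refine hLM (hα.eq_of_dvd hβ hL hM (Dvd.intro_left (C c) ?_))
    rw [C_mul', hc]
  have hfin : Module.Finite k (homogeneousSubmodule (Fin 2) k 1) := by
    rw [homogeneousSubmodule_one_eq_span_X]
    exact Module.Finite.span_of_finite k (Set.finite_range _)
  refine Submodule.eq_of_le_of_finrank_le ?_ ?_
  · rw [Submodule.span_le]
    rintro _ (rfl | rfl)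
    · exact hα.1
    · exact hβ.1
  · have h1 := finrank_span_eq_card hind
    rw [Matrix.range_cons, Matrix.range_cons, Matrix.range_empty, Set.union_empty,
      Set.singleton_union] at h1
    rw [h1, homogeneousSubmodule_one_eq_span_X]
    exact finrank_range_le_card _

theorem exists_two_lines (h : 2 ≤ A.lines.card) :
    ∃ L ∈ A.lines, ∃ M ∈ A.lines, L ≠ M := by
  obtain ⟨L, M, hL, hM, hLM⟩ := Finset.one_lt_card_iff.1 (show 1 < A.lines.card by omega)
  exact ⟨L, hL, M, hM, hLM⟩

section

variable [CharZero k]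

theorem exists_apply_polyIncl_eq (φ : A.diffOps ≃ₐ[k] A'.diffOps) {h : MvPolynomial (Fin 2) k}
    (hh : A.IsSemiInvariant h) :
    ∃ h', A'.IsSemiInvariant h' ∧ φ (A.polyIncl h) = A'.polyIncl h' := by
  refine exists_isSemiInvariant_of_isNormalElement (hh.isNormalElement.map φ) ?_
  rw [Ne, EmbeddingLike.map_eq_zero_iff, map_eq_zero_iff _ A.polyIncl_injective]
  exact hh.1

/-- Isomorphisms take linear forms of lines to linear forms of lines. -/
theorem exists_line (φ : A.diffOps ≃ₐ[k] A'.diffOps) {L : Submodule k (Fin 2 → k)}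
    (hL : L ∈ A.lines) : ∃ L' ∈ A'.lines, ∀ α, IsLinearFormOf α L →
      ∃ α', IsLinearFormOf α' L' ∧ φ (A.polyIncl α) = A'.polyIncl α' := by
  have hrank := A.finrank_eq_one L hL
  obtain ⟨α, hα⟩ := exists_isLinearFormOf L hrank
  suffices H : ∃ L' ∈ A'.lines, ∃ α', IsLinearFormOf α' L' ∧
      φ (A.polyIncl α) = A'.polyIncl α' by
    obtain ⟨L', hL', α', hα', h⟩ := H
    refine ⟨L', hL', fun β hβ => ?_⟩
    obtain ⟨c, hc, rfl⟩ := hβ.exists_eq_C_mul hα hrank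
    exact ⟨C c * α', hα'.C_mul hc, by rw [map_mul, map_mul, h, apply_polyIncl_C, map_mul]⟩
  obtain ⟨h', hh', hφ⟩ :=
    exists_apply_polyIncl_eq φ (A.isSemiInvariant_of_isLinearFormOf hL hα)
  have hunit : ¬ IsUnit h' := by
    intro hu
    obtain ⟨c, -, rfl⟩ := isUnit_iff_eq_C_of_isReduced.1 hu
    exact hα.not_eq_C hrank c (eq_C_of_apply_polyIncl_eq φ hφ)
  obtain ⟨L', hL', α', hα', g, rfl⟩ := hh'.exists_isLinearFormOf_dvd hunit
  have hrank' := A'.finrank_eq_one L' hL'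
  have hα'' := A'.isSemiInvariant_of_isLinearFormOf hL' hα'
  obtain ⟨a, -, ha⟩ := exists_apply_polyIncl_eq φ.symm hα''
  obtain ⟨b, -, hb⟩ := exists_apply_polyIncl_eq φ.symm (hα''.of_mul hh')
  -- Both factors of `h'` are semi-invariant, so they pull back to polynomials factoring the
  -- irreducible `α`. The factor `a` is not constant because `α'` is not; hence `b`, and with it
  -- `g`, is a nonzero constant.
  have hab : α = a * b := by
    apply A.polyIncl_injective
    rw [map_mul, ← ha, ← hb, ← map_mul, ← map_mul, ← hφ, φ.symm_apply_apply]
  refine ⟨L', hL', α' * g, ?_, hφ⟩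
  rcases (hα.prime hrank).irreducible.isUnit_or_isUnit hab with hu | hu
  · obtain ⟨c, -, rfl⟩ := isUnit_iff_eq_C_of_isReduced.1 hu
    exact absurd (eq_C_of_apply_polyIncl_eq φ.symm ha) (hα'.not_eq_C hrank' c)
  · obtain ⟨c, hc, rfl⟩ := isUnit_iff_eq_C_of_isReduced.1 hu
    rw [eq_C_of_apply_polyIncl_eq φ.symm hb, mul_comm]
    exact hα'.C_mul hc.ne_zero

/-- The map on lines induced by an isomorphism of algebras of differential operators. -/
theorem exists_lineMap (φ : A.diffOps ≃ₐ[k] A'.diffOps) :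
    ∃ σ : Submodule k (Fin 2 → k) → Submodule k (Fin 2 → k),
      Set.MapsTo σ A.lines A'.lines ∧ Set.InjOn σ A.lines ∧
      ∀ L ∈ A.lines, ∀ α, IsLinearFormOf α L →
        ∃ α', IsLinearFormOf α' (σ L) ∧ φ (A.polyIncl α) = A'.polyIncl α' := by
  choose! σ hσ hσ' using fun L (hL : L ∈ A.lines) => exists_line φ hL
  refine ⟨σ, hσ, ?_, hσ'⟩
  intro L hL M hM hLM
  have hrL := A.finrank_eq_one L hL
  have hrM := A.finrank_eq_one M hM
  obtain ⟨α, hα⟩ := exists_isLinearFormOf L hrL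
  obtain ⟨β, hβ⟩ := exists_isLinearFormOf M hrM
  obtain ⟨α', hα', h1⟩ := hσ' L hL α hα
  obtain ⟨β', hβ', h2⟩ := hσ' M hM β hβ
  rw [← hLM] at hβ'
  -- Forms of the same image line are proportional; as `φ` fixes scalars and is injective, so are
  -- `α` and `β`.
  obtain ⟨c, hc, rfl⟩ := hα'.exists_eq_C_mul hβ' (A'.finrank_eq_one _ (hσ L hL))
  rw [map_mul, ← h2, ← apply_polyIncl_C φ, ← map_mul, ← map_mul] at h1
  have h3 := A.polyIncl_injective (φ.injective h1)
  refine (hβ.eq_of_dvd hα hrM hrL ?_).symm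
  exact Dvd.intro_left _ h3.symm

theorem card_lines_eq (φ : A.diffOps ≃ₐ[k] A'.diffOps) : A.lines.card = A'.lines.card := by
  obtain ⟨σ, h1, h2, -⟩ := exists_lineMap φ
  obtain ⟨τ, h1', h2', -⟩ := exists_lineMap φ.symm
  exact le_antisymm (Finset.card_le_card_of_injOn σ h1 h2)
    (Finset.card_le_card_of_injOn τ h1' h2')

/-- Isomorphisms preserve polynomials, and preserve linear forms. -/
theorem apply_polyIncl_mem_range (hA : 2 ≤ A.lines.card) (φ : A.diffOps ≃ₐ[k] A'.diffOps) :
    (∀ f, ∃ g, φ (A.polyIncl f) = A'.polyIncl g) ∧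
    ∀ f : MvPolynomial (Fin 2) k, f.IsHomogeneous 1 →
      ∃ g : MvPolynomial (Fin 2) k, g.IsHomogeneous 1 ∧ φ (A.polyIncl f) = A'.polyIncl g := by
  obtain ⟨L, hL, M, hM, hLM⟩ := exists_two_lines hA
  have hrL := A.finrank_eq_one L hL
  have hrM := A.finrank_eq_one M hM
  obtain ⟨α, hα⟩ := exists_isLinearFormOf L hrL
  obtain ⟨β, hβ⟩ := exists_isLinearFormOf M hrM
  have hspan := span_pair_eq hα hβ hrL hrM hLM
  obtain ⟨σ, -, -, hσ⟩ := exists_lineMap φ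
  have hlin : ∀ f : MvPolynomial (Fin 2) k, f.IsHomogeneous 1 →
      ∃ g : MvPolynomial (Fin 2) k, g.IsHomogeneous 1 ∧ φ (A.polyIncl f) = A'.polyIncl g := by
    intro f hf
    rw [← mem_homogeneousSubmodule, ← hspan, Submodule.mem_span_pair] at hf
    obtain ⟨a, b, rfl⟩ := hf
    obtain ⟨α', hα', h1⟩ := hσ L hL α hα
    obtain ⟨β', hβ', h2⟩ := hσ M hM β hβ
    refine ⟨a • α' + b • β', ?_, ?_⟩
    · rw [← mem_homogeneousSubmodule]
      exact Submodule.add_mem _ (Submodule.smul_mem _ _ hα'.1) (Submodule.smul_mem _ _ hβ'.1)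
    · simp only [map_add, map_smul, h1, h2]
  refine ⟨fun f => ?_, hlin⟩
  induction f using MvPolynomial.induction_on with
  | C a => exact ⟨C a, apply_polyIncl_C φ a⟩
  | add p q hp hq =>
    obtain ⟨p', hp'⟩ := hp
    obtain ⟨q', hq'⟩ := hq
    exact ⟨p' + q', by rw [map_add, map_add, hp', hq', map_add]⟩
  | mul_X p i hp =>
    obtain ⟨p', hp'⟩ := hp
    obtain ⟨q', -, hq'⟩ := hlin (X i) (isHomogeneous_X k i)
    exact ⟨p' * q', by rw [map_mul, map_mul, hp', hq', map_mul]⟩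

/-- The automorphism of the polynomial ring induced by an isomorphism. -/
theorem exists_polyEquiv (hA : 2 ≤ A.lines.card) (φ : A.diffOps ≃ₐ[k] A'.diffOps) :
    ∃ ψ : MvPolynomial (Fin 2) k ≃ₐ[k] MvPolynomial (Fin 2) k,
      (∀ f, φ (A.polyIncl f) = A'.polyIncl (ψ f)) ∧
      (∀ f : MvPolynomial (Fin 2) k, f.IsHomogeneous 1 → (ψ f).IsHomogeneous 1) ∧
      ∀ f : MvPolynomial (Fin 2) k, f.IsHomogeneous 1 → (ψ.symm f).IsHomogeneous 1 := by
  obtain ⟨h1, h1'⟩ := apply_polyIncl_mem_range hA φ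
  obtain ⟨h2, h2'⟩ := apply_polyIncl_mem_range (by rwa [← card_lines_eq φ]) φ.symm
  choose ψ hψ using h1
  choose χ hχ using h2
  have hinj := A.polyIncl_injective
  have hinj' := A'.polyIncl_injective
  let Ψ : MvPolynomial (Fin 2) k →ₐ[k] MvPolynomial (Fin 2) k :=
    { toFun := ψ
      map_one' := hinj' (by rw [← hψ, map_one, map_one, map_one])
      map_mul' := fun f g => hinj' (by rw [← hψ, map_mul, map_mul, hψ, hψ, map_mul])
      map_zero' := hinj' (by rw [← hψ, map_zero, map_zero, map_zero])
      map_add' := fun f g => hinj' (by rw [← hψ, map_add, map_add, hψ, hψ, map_add])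
      commutes' := fun c => hinj' (by
        rw [← hψ]
        exact apply_polyIncl_C φ c) }
  have hl : Function.LeftInverse χ ψ := fun f => hinj (by
    rw [← hχ, ← hψ, φ.symm_apply_apply])
  have hr : Function.RightInverse χ ψ := fun f => hinj' (by
    rw [← hψ, ← hχ, φ.apply_symm_apply])
  refine ⟨{ Ψ with invFun := χ, left_inv := hl, right_inv := hr }, hψ, fun f hf => ?_,
    fun f hf => ?_⟩
  · obtain ⟨g, hg, hfg⟩ := h1' f hf
    have : ψ f = g := hinj' (by rw [← hψ, hfg])
    change (ψ f).IsHomogeneous 1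
    rwa [this]
  · obtain ⟨g, hg, hfg⟩ := h2' f hf
    have : χ f = g := hinj (by rw [← hχ, hfg])
    change (χ f).IsHomogeneous 1
    rwa [this]

end

/-- An algebra map taking linear forms of the lines to linear forms of their images under a
bijection of lines takes defining polynomials to defining polynomials, up to a scalar. -/
theorem exists_apply_eq_C_mul {F : Type*}
    [FunLike F (MvPolynomial (Fin 2) k) (MvPolynomial (Fin 2) k)]
    [AlgHomClass F k (MvPolynomial (Fin 2) k) (MvPolynomial (Fin 2) k)]
    (ψ : F) {σ : Submodule k (Fin 2 → k) → Submodule k (Fin 2 → k)}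
    (hσ : Set.BijOn σ A.lines A'.lines)
    (hψ : ∀ L ∈ A.lines, ∀ α, IsLinearFormOf α L → IsLinearFormOf (ψ α) (σ L))
    {Q Q' : MvPolynomial (Fin 2) k} (hQ : A.IsDefiningPolynomial Q)
    (hQ' : A'.IsDefiningPolynomial Q') : ∃ c : k, c ≠ 0 ∧ ψ Q = C c * Q' := by
  obtain ⟨α, hα, rfl⟩ := hQ
  obtain ⟨β, hβ, rfl⟩ := hQ'
  have h : ∀ L ∈ A.lines, ∃ c : k, c ≠ 0 ∧ ψ (α L) = C c * β (σ L) := fun L hL =>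
    (hψ L hL _ (hα L hL)).exists_eq_C_mul (hβ _ (hσ.mapsTo hL))
      (A'.finrank_eq_one _ (hσ.mapsTo hL))
  choose! c hc hc' using h
  refine ⟨∏ L ∈ A.lines, c L, Finset.prod_ne_zero_iff.2 hc, ?_⟩
  rw [map_prod, Finset.prod_congr rfl hc', Finset.prod_mul_distrib, map_prod]
  congr 1
  exact Finset.prod_nbij σ hσ.mapsTo hσ.injOn hσ.surjOn fun _ _ => rfl

end CentralLineArrangement

/-! ### Linear changes of coordinates, on points and on polynomials. -/

section LinearChange

variable {k : Type*} [Field k]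

/-- Duality between `ψ` and the self-map of the plane with coordinates `ψ (X i)`: applying `ψ` is
composing with that map. -/
theorem eval_algHom_apply {F : Type*}
    [FunLike F (MvPolynomial (Fin 2) k) (MvPolynomial (Fin 2) k)]
    [AlgHomClass F k (MvPolynomial (Fin 2) k) (MvPolynomial (Fin 2) k)] (ψ : F)
    (p : Fin 2 → k) (f : MvPolynomial (Fin 2) k) :
    eval p (ψ f) = eval (fun i => eval p (ψ (X i))) f := by
  induction f using MvPolynomial.induction_on with
  | C a => rw [← algebraMap_eq, AlgHomClass.commutes, algebraMap_eq, eval_C, eval_C]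
  | add p q hp hq => simp only [map_add, hp, hq]
  | mul_X p i hp => simp only [map_mul, hp, eval_X]

theorem isLinearMap_eval {α : MvPolynomial (Fin 2) k} (hα : α.IsHomogeneous 1) :
    IsLinearMap k fun p : Fin 2 → k => eval p α := by
  obtain ⟨a, b, rfl⟩ := exists_eq_of_isHomogeneous_one hα
  constructor
  · intro p q
    simp
    ring
  · intro c p
    simp
    ring

/-- The linear automorphism of the plane dual to a linear automorphism of the polynomial ring. -/
def planeEquiv (ψ : MvPolynomial (Fin 2) k ≃ₐ[k] MvPolynomial (Fin 2) k)
    (hψ : ∀ i, (ψ (X i)).IsHomogeneous 1) : (Fin 2 → k) ≃ₗ[k] (Fin 2 → k) where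
  toFun p i := eval p (ψ (X i))
  map_add' p q := funext fun i => (isLinearMap_eval (hψ i)).map_add p q
  map_smul' c p := funext fun i => (isLinearMap_eval (hψ i)).map_smul c p
  invFun p i := eval p (ψ.symm (X i))
  left_inv p := funext fun i => by
    beta_reduce
    rw [← eval_algHom_apply, ψ.apply_symm_apply, eval_X]
  right_inv p := funext fun i => by
    beta_reduce
    rw [← eval_algHom_apply, ψ.symm_apply_apply, eval_X]

/-- Composition of polynomials with a linear endomorphism of the plane. -/
def linearComp (g : (Fin 2 → k) →ₗ[k] (Fin 2 → k)) :
    MvPolynomial (Fin 2) k →ₐ[k] MvPolynomial (Fin 2) k :=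
  aeval fun i => C (g (Pi.single 0 1) i) * X 0 + C (g (Pi.single 1 1) i) * X 1

theorem eval_linearComp (g : (Fin 2 → k) →ₗ[k] (Fin 2 → k)) (p : Fin 2 → k)
    (f : MvPolynomial (Fin 2) k) : eval p (linearComp g f) = eval (g p) f := by
  rw [eval_algHom_apply]
  congr 2
  ext i
  have hp : p = p 0 • Pi.single 0 1 + p 1 • Pi.single 1 1 := by
    ext j
    fin_cases j <;> simp
  conv_rhs => rw [hp, map_add, map_smul, map_smul]
  simp [linearComp, mul_comm]

theorem isHomogeneous_linearComp (g : (Fin 2 → k) →ₗ[k] (Fin 2 → k))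
    {f : MvPolynomial (Fin 2) k} (hf : f.IsHomogeneous 1) : (linearComp g f).IsHomogeneous 1 := by
  obtain ⟨a, b, rfl⟩ := exists_eq_of_isHomogeneous_one hf
  rw [map_add, map_mul, map_mul, ← algebraMap_eq, AlgHom.commutes, AlgHom.commutes, algebraMap_eq]
  have h : ∀ i, (linearComp g (X i)).IsHomogeneous 1 := fun i => by
    rw [linearComp, aeval_X]
    exact ((isHomogeneous_X k 0).C_mul _).add ((isHomogeneous_X k 1).C_mul _)
  exact ((h 0).C_mul a).add ((h 1).C_mul b)

/-- Composition of polynomials with a linear automorphism of the plane. -/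
def linearCompEquiv [Infinite k] (g : (Fin 2 → k) ≃ₗ[k] (Fin 2 → k)) :
    MvPolynomial (Fin 2) k ≃ₐ[k] MvPolynomial (Fin 2) k :=
  AlgEquiv.ofAlgHom (linearComp g) (linearComp g.symm)
    (AlgHom.ext fun f => MvPolynomial.funext fun p => by
      simp [eval_linearComp])
    (AlgHom.ext fun f => MvPolynomial.funext fun p => by
      simp [eval_linearComp])

/-- Conjugation of a derivation by an algebra automorphism. -/
def conjDerivation (ψ : MvPolynomial (Fin 2) k ≃ₐ[k] MvPolynomial (Fin 2) k)
    (d : Derivation k (MvPolynomial (Fin 2) k) (MvPolynomial (Fin 2) k)) :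
    Derivation k (MvPolynomial (Fin 2) k) (MvPolynomial (Fin 2) k) :=
  Derivation.mk' (ψ.toLinearEquiv.conj d.toLinearMap) fun f g => by
    simp [LinearEquiv.conj_apply]

theorem conjDerivation_apply (ψ : MvPolynomial (Fin 2) k ≃ₐ[k] MvPolynomial (Fin 2) k)
    (d : Derivation k (MvPolynomial (Fin 2) k) (MvPolynomial (Fin 2) k))
    (f : MvPolynomial (Fin 2) k) : conjDerivation ψ d f = ψ (d (ψ.symm f)) := rfl

end LinearChange

/-! ### Conjugation of operator algebras, and linear isomorphism of arrangements. -/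

namespace CentralLineArrangement

variable {k : Type*} [Field k] {A A' : CentralLineArrangement k}

/-- Conjugation by `ψ` sends multiplication by `f` to multiplication by `ψ f`, and derivations
logarithmic for `Q` to derivations logarithmic for `ψ Q`, a unit multiple of `Q'`. -/
theorem conj_mem_diffOps {ψ : MvPolynomial (Fin 2) k ≃ₐ[k] MvPolynomial (Fin 2) k} {c : k}
    (hc : c ≠ 0) (hψ : ψ A.definingPolynomial = C c * A'.definingPolynomial)
    {T : Module.End k (MvPolynomial (Fin 2) k)} (hT : T ∈ A.diffOps) :
    ψ.toLinearEquiv.conjAlgEquiv k T ∈ A'.diffOps := by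
  refine Algebra.adjoin_induction
    (p := fun T _ => ψ.toLinearEquiv.conjAlgEquiv k T ∈ A'.diffOps) ?_ ?_ ?_ ?_ hT
  · rintro _ (⟨f, rfl⟩ | ⟨d, hd, rfl⟩)
    · refine Algebra.subset_adjoin (Or.inl ⟨ψ f, ?_⟩)
      refine LinearMap.ext fun g => ?_
      change ψ f * g = ψ (f * ψ.symm g)
      rw [map_mul, ψ.apply_symm_apply]
    · refine Algebra.subset_adjoin (Or.inr ⟨conjDerivation ψ d, ?_, rfl⟩)
      have h1 : ψ.symm A'.definingPolynomial = C c⁻¹ * A.definingPolynomial := by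
        rw [ψ.symm_apply_eq, map_mul, hψ, ← algebraMap_eq, ψ.commutes, algebraMap_eq, ← mul_assoc,
          ← map_mul, inv_mul_cancel₀ hc, C_1, one_mul]
      rw [mem_logDer, conjDerivation_apply, h1, C_mul', Derivation.map_smul, map_smul]
      obtain ⟨g, hg⟩ := mem_logDer.1 hd
      rw [hg, map_mul, hψ, ← C_mul']
      exact ⟨C c⁻¹ * C c * ψ g, by ring⟩
  · intro r
    rw [AlgEquiv.commutes]
    exact A'.diffOps.algebraMap_mem r
  · intro T U _ _ hT hU
    rw [map_add]
    exact add_mem hT hU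
  · intro T U _ _ hT hU
    rw [map_mul]
    exact mul_mem hT hU

theorem nonempty_algEquiv {ψ : MvPolynomial (Fin 2) k ≃ₐ[k] MvPolynomial (Fin 2) k} {c : k}
    (hc : c ≠ 0) (hψ : ψ A.definingPolynomial = C c * A'.definingPolynomial) :
    Nonempty (A.diffOps ≃ₐ[k] A'.diffOps) := by
  have h : A.diffOps.map (ψ.toLinearEquiv.conjAlgEquiv k).toAlgHom = A'.diffOps := by
    apply le_antisymm
    · rintro _ ⟨T, hT, rfl⟩
      exact conj_mem_diffOps hc hψ hT
    · intro U hU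
      have h1 : ψ.symm A'.definingPolynomial = C c⁻¹ * A.definingPolynomial := by
        rw [ψ.symm_apply_eq, map_mul, hψ, ← algebraMap_eq, ψ.commutes, algebraMap_eq, ← mul_assoc,
          ← map_mul, inv_mul_cancel₀ hc, C_1, one_mul]
      exact ⟨_, conj_mem_diffOps (inv_ne_zero hc) h1 hU,
        (ψ.toLinearEquiv.conjAlgEquiv k).apply_symm_apply U⟩
  exact ⟨((ψ.toLinearEquiv.conjAlgEquiv k).subalgebraMap A.diffOps).trans
    (Subalgebra.equivOfEq _ _ h)⟩

theorem linearlyIsomorphic_of_card_le_one (h : A.lines.card = A'.lines.card)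
    (hA : A.lines.card ≤ 1) : A.LinearlyIsomorphic A' := by
  rcases Nat.le_one_iff_eq_zero_or_eq_one.1 hA with h0 | h0
  · have h0' := h ▸ h0
    rw [Finset.card_eq_zero] at h0 h0'
    exact ⟨LinearEquiv.refl k _, by simp [h0, h0']⟩
  · have h0' := h ▸ h0
    obtain ⟨L, hL⟩ := Finset.card_eq_one.1 h0
    obtain ⟨L', hL'⟩ := Finset.card_eq_one.1 h0'
    have e : L ≃ₗ[k] L' := LinearEquiv.ofFinrankEq L L' (by
      rw [A.finrank_eq_one L (by simp [hL]), A'.finrank_eq_one L' (by simp [hL'])])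
    -- Any isomorphism between two lines extends to an automorphism of the plane.
    obtain ⟨g, hg⟩ := Submodule.exists_linearEquiv_restrict_eq e
    refine ⟨g, ?_⟩
    rw [hL, hL', Finset.coe_singleton, Finset.coe_singleton, Set.image_singleton,
      Set.singleton_eq_singleton_iff]
    ext p
    constructor
    · rintro ⟨q, hq, rfl⟩
      have := hg ⟨q, hq⟩
      exact this ▸ (e ⟨q, hq⟩).2
    · intro hp
      refine ⟨e.symm ⟨p, hp⟩, (e.symm ⟨p, hp⟩).2, ?_⟩
      exact (hg _).symm.trans (by rw [e.apply_symm_apply])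

variable [CharZero k]

theorem LinearlyIsomorphic.nonempty_algEquiv (h : A.LinearlyIsomorphic A') :
    Nonempty (A.diffOps ≃ₐ[k] A'.diffOps) := by
  obtain ⟨g, hg⟩ := h
  have hbij : Set.BijOn (fun L : Submodule k (Fin 2 → k) => L.map g.toLinearMap)
      A.lines A'.lines := by
    rw [← hg]
    exact (Submodule.map_injective_of_injective g.injective).injOn.bijOn_image
  -- The inverse appears because the form vanishing on `g(L)` is `α ∘ g⁻¹`.
  have hform : ∀ L ∈ A.lines, ∀ α, IsLinearFormOf α L →
      IsLinearFormOf (linearCompEquiv g.symm α) (L.map g.toLinearMap) := by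
    intro L _ α hα
    refine ⟨isHomogeneous_linearComp _ hα.1, fun p => ?_⟩
    exact (Eq.congr_left (eval_linearComp _ p α)).trans
      ((hα.2 _).trans (Submodule.mem_map_equiv L (e := g)).symm)
  obtain ⟨c, hc, hψ⟩ := exists_apply_eq_C_mul (linearCompEquiv g.symm) hbij hform
    A.isDefiningPolynomial_definingPolynomial A'.isDefiningPolynomial_definingPolynomial
  exact CentralLineArrangement.nonempty_algEquiv hc hψ

/-- The bijection of lines induced by an isomorphism. -/
theorem exists_lineMap_bijOn (φ : A.diffOps ≃ₐ[k] A'.diffOps)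
    {ψ : MvPolynomial (Fin 2) k ≃ₐ[k] MvPolynomial (Fin 2) k}
    (hψ : ∀ f, φ (A.polyIncl f) = A'.polyIncl (ψ f)) :
    ∃ σ : Submodule k (Fin 2 → k) → Submodule k (Fin 2 → k),
      Set.BijOn σ A.lines A'.lines ∧
      ∀ L ∈ A.lines, ∀ α, IsLinearFormOf α L → IsLinearFormOf (ψ α) (σ L) := by
  obtain ⟨σ, h1, h2, h3⟩ := exists_lineMap φ
  refine ⟨σ, ⟨h1, h2, Finset.surjOn_of_injOn_of_card_le σ h1 h2 (card_lines_eq φ).ge⟩, ?_⟩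
  intro L hL α hα
  obtain ⟨α', hα', h⟩ := h3 L hL α hα
  rw [hψ] at h
  rwa [A'.polyIncl_injective h]

theorem linearlyIsomorphic_of_algEquiv (φ : A.diffOps ≃ₐ[k] A'.diffOps) :
    A.LinearlyIsomorphic A' := by
  rcases Nat.lt_or_ge A.lines.card 2 with hA | hA
  · exact linearlyIsomorphic_of_card_le_one (card_lines_eq φ) (by omega)
  obtain ⟨ψ, hψ, hlin, -⟩ := exists_polyEquiv hA φ
  obtain ⟨σ, hσ, hform⟩ := exists_lineMap_bijOn φ hψ
  -- Since `ψ α` is `α` composed with `planeEquiv ψ`, that map carries `σ L` to `L`; its inverse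
  -- goes the required way.
  refine ⟨(planeEquiv ψ fun i => hlin _ (isHomogeneous_X k i)).symm, ?_⟩
  rw [← hσ.image_eq]
  refine Set.image_congr fun L hL => ?_
  obtain ⟨α, hα⟩ := exists_isLinearFormOf L (A.finrank_eq_one L hL)
  ext p
  rw [Submodule.mem_map_equiv, LinearEquiv.symm_symm, ← (hform L hL α hα).2, ← hα.2,
    eval_algHom_apply ψ]
  exact Iff.rfl

end CentralLineArrangement

end LineArrangement

end

theorem mainTheorem11 {k : Type*} [Field k] [CharZero k]
    (A A' : LineArrangement.CentralLineArrangement k) :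
    (Nonempty (A.diffOps ≃ₐ[k] A'.diffOps) ↔ A.LinearlyIsomorphic A') ∧
    (2 ≤ A.lines.card → ∀ φ : A.diffOps ≃ₐ[k] A'.diffOps,
      ∃ ψ : MvPolynomial (Fin 2) k ≃ₐ[k] MvPolynomial (Fin 2) k,
        (∀ f, φ (A.polyIncl f) = A'.polyIncl (ψ f)) ∧
        (MvPolynomial.homogeneousSubmodule (Fin 2) k 1).map ψ.toLinearMap =
          MvPolynomial.homogeneousSubmodule (Fin 2) k 1 ∧
        ∀ Q Q' : MvPolynomial (Fin 2) k,
          A.IsDefiningPolynomial Q → A'.IsDefiningPolynomial Q' →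
            ∃ c : k, c ≠ 0 ∧ ψ Q = MvPolynomial.C c * Q') := by
  refine ⟨⟨fun ⟨φ⟩ => LineArrangement.CentralLineArrangement.linearlyIsomorphic_of_algEquiv φ,
    fun h => h.nonempty_algEquiv⟩, fun hA φ => ?_⟩
  obtain ⟨ψ, hψ, hlin, hlin'⟩ :=
    LineArrangement.CentralLineArrangement.exists_polyEquiv hA φ
  refine ⟨ψ, hψ, ?_, fun Q Q' hQ hQ' => ?_⟩
  · apply le_antisymm
    · rintro _ ⟨f, hf, rfl⟩
      exact hlin f hf
    · intro f hf
      exact ⟨ψ.symm f, hlin' f hf, ψ.apply_symm_apply f⟩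
  · obtain ⟨σ, hσ, hform⟩ :=
      LineArrangement.CentralLineArrangement.exists_lineMap_bijOn φ hψ
    exact LineArrangement.CentralLineArrangement.exists_apply_eq_C_mul ψ hσ hform hQ hQ'
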